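/- Let $G$ be a countably infinite discrete amenable group and let $(F_N)_{N\ge 1}$ be a right-Følner sequence in $G$, i.e. a sequence of nonempty finite subsets of $G$ with $|F_N\triangle F_Ng|/|F_N|\to 0$ for every $g\in G$. Let $\mathcal H$ be a complex Hilbert space and let $u:G\to\mathcal H$ be bounded. Suppose that $$\sum_{h\in G}\ \limsup_{N\to\infty}\left|\frac1{|F_N|}\sum_{g\in F_N}\langle u(gh),u(g)\rangle\right|^2<\infty .$$ Then $u$ is spectrally Lebesgue, in the following sense. For $h\in G$ put $(U_hu)(g)=u(gh)$. Let $N_1<N_2<\cdots$ be any sequence of indices such that $((U_hu)_{h\in G},(F_{N_q})_{q})$ is a permissible pair, i.e. the limit $$\langle x,y\rangle_{\mathscr H}=\lim_{q\to\infty}\frac1{|F_{N_q}|}\sum_{g\in F_{N_q}}\langle x(g),y(g)\rangle$$ exists for all $x,y\in\{U_hu: h\in G\}$. Let $\mathscr H'$ be the complex linear span of $\{U_hu:h\in G\}$, let $\mathscr H''$ be the space of all $E:G\to\mathcal H$ with $\limsup_q\frac1{|F_{N_q}|}\sum_{g\in F_{N_q}}\|E(g)\|^2<\infty$ such that for every $\varepsilon>0$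 there is $E_\varepsilon\in\mathscr H'$ with $\limsup_q\frac1{|F_{N_q}|}\sum_{g\in F_{N_q}}\|E(g)-E_\varepsilon(g)\|^2<\varepsilon$, and let $\mathscr H=\mathscr H''/S$ with the inner product $\langle\cdot,\cdot\rangle_{\mathscr H}$ (the limit above exists for all $x,y\in\mathscr H''$), where $S$ is the set of $x\in\mathscr H''$ with $\lim_q\frac1{|F_{N_q}|}\sum_{g\in F_{N_q}}\|x(g)\|^2=0$. Then there is exactly one unitary representation $U$ of $G$ on $\mathscr H$ such that, for all $g,h\in G$, $U_g$ maps the class of $U_hu$ to the class of $U_{gh}u$, and $U$ is unitarily equivalent to a subrepresentation of the left regular representation $(L_gf)(x)=f(g^{-1}x)$ of $G$ on $\ell^2(G)$, that is, to its restriction to some closed invariant subspace of $\ell^2(G)$. -/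

import Mathlib

open Filter Topology


namespace VdC

noncomputable section

/-- A right Følner sequence of (nonempty) finite subsets of `G`:
`|F_n ∆ F_n g| / |F_n| → 0` for every `g`. -/
def IsRightFolner {G : Type*} [Group G] (F : ℕ → Finset G) : Prop :=
  (∀ n, (F n).Nonempty) ∧
    ∀ g : G, Tendsto
      (fun n => ((symmDiff (F n : Set G) ((fun x => x * g) '' (F n : Set G))).ncard : ℝ) /
        ((F n).card : ℝ))
      atTop (𝓝 0)

/-- The average `(1/|A|) ∑_{g ∈ A} φ g`. -/
def avg {G E : Type*} [AddCommGroup E] [Module ℝ E] (A : Finset G) (φ : G → E) : E :=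
  (A.card : ℝ)⁻¹ • ∑ g ∈ A, φ g

section Averages

variable {G H : Type*} [NormedAddCommGroup H] [InnerProductSpace ℂ H]

theorem avg_sq_nonneg (A : Finset G) (x : G → H) : 0 ≤ avg A (fun g => ‖x g‖ ^ 2) :=
  smul_nonneg (by positivity) (Finset.sum_nonneg fun _ _ => by positivity)

theorem avg_sq_add_le (A : Finset G) (x y : G → H) :
    avg A (fun g => ‖(x + y) g‖ ^ 2) ≤
      2 * avg A (fun g => ‖x g‖ ^ 2) + 2 * avg A (fun g => ‖y g‖ ^ 2) := by
  have h : ∑ g ∈ A, ‖(x + y) g‖ ^ 2 ≤ 2 * ∑ g ∈ A, ‖x g‖ ^ 2 + 2 * ∑ g ∈ A, ‖y g‖ ^ 2 := by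
    rw [Finset.mul_sum, Finset.mul_sum, ← Finset.sum_add_distrib]
    refine Finset.sum_le_sum fun g _ => ?_
    have h1 : ‖(x + y) g‖ ≤ ‖x g‖ + ‖y g‖ := norm_add_le _ _
    nlinarith [norm_nonneg ((x + y) g), sq_nonneg (‖x g‖ - ‖y g‖)]
  have h2 := mul_le_mul_of_nonneg_left h (show (0 : ℝ) ≤ (A.card : ℝ)⁻¹ by positivity)
  simp only [avg, smul_eq_mul]
  linarith

theorem avg_sq_smul (A : Finset G) (c : ℂ) (x : G → H) :
    avg A (fun g => ‖(c • x) g‖ ^ 2) = ‖c‖ ^ 2 * avg A (fun g => ‖x g‖ ^ 2) := by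
  simp only [avg, Pi.smul_apply, norm_smul, mul_pow, ← Finset.mul_sum, smul_eq_mul]
  ring

theorem avg_inner_add_left (A : Finset G) (x y z : G → H) :
    avg A (fun g => inner ℂ ((x + y) g) (z g)) =
      avg A (fun g => inner ℂ (x g) (z g)) + avg A (fun g => inner ℂ (y g) (z g)) := by
  simp only [avg, Pi.add_apply, inner_add_left, Finset.sum_add_distrib, smul_add]

theorem avg_inner_smul_left (A : Finset G) (c : ℂ) (x y : G → H) :
    avg A (fun g => inner ℂ ((c • x) g) (y g)) =
      (starRingEnd ℂ) c * avg A (fun g => inner ℂ (x g) (y g)) := by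
  simp only [avg, Pi.smul_apply, inner_smul_left, ← Finset.mul_sum, mul_smul_comm]

theorem avg_inner_conj (A : Finset G) (x y : G → H) :
    (starRingEnd ℂ) (avg A (fun g => inner ℂ (y g) (x g))) =
      avg A (fun g => inner ℂ (x g) (y g)) := by
  simp [avg]

theorem avg_inner_self (A : Finset G) (x : G → H) :
    avg A (fun g => inner ℂ (x g) (x g)) = ((avg A (fun g => ‖x g‖ ^ 2) : ℝ) : ℂ) := by
  simp [avg, inner_self_eq_norm_sq_to_K]

theorem avg_inner_sq_le (A : Finset G) (x y : G → H) :
    ‖avg A (fun g => inner ℂ (x g) (y g))‖ ^ 2 ≤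
      avg A (fun g => ‖x g‖ ^ 2) * avg A (fun g => ‖y g‖ ^ 2) := by
  have h1 : ‖∑ g ∈ A, inner ℂ (x g) (y g)‖ ≤ ∑ g ∈ A, ‖x g‖ * ‖y g‖ :=
    (norm_sum_le _ _).trans (Finset.sum_le_sum fun g _ => norm_inner_le_norm _ _)
  have h2 : ‖∑ g ∈ A, inner ℂ (x g) (y g)‖ ^ 2 ≤
      (∑ g ∈ A, ‖x g‖ ^ 2) * ∑ g ∈ A, ‖y g‖ ^ 2 :=
    (pow_le_pow_left₀ (norm_nonneg _) h1 2).trans (Finset.sum_mul_sq_le_sq_mul_sq _ _ _)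
  have h3 := mul_le_mul_of_nonneg_left h2 (show (0 : ℝ) ≤ ((A.card : ℝ)⁻¹) ^ 2 by positivity)
  simp only [avg, smul_eq_mul, norm_smul, mul_pow, norm_inv, Real.norm_natCast]
  linarith

/-- `f ∈ SA(H, (F_n))`: `limsup_n (1/|F_n|) ∑_{g ∈ F_n} ‖f g‖² < ∞`. -/
def SquareAverageable (F : ℕ → Finset G) (f : G → H) : Prop :=
  IsBoundedUnder (· ≤ ·) atTop (fun n => avg (F n) (fun g => ‖f g‖ ^ 2))

theorem SquareAverageable.add {F : ℕ → Finset G} {x y : G → H}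
    (hx : SquareAverageable F x) (hy : SquareAverageable F y) : SquareAverageable F (x + y) := by
  obtain ⟨a, ha⟩ := hx
  obtain ⟨b, hb⟩ := hy
  rw [eventually_map] at ha hb
  refine ⟨2 * a + 2 * b, ?_⟩
  rw [eventually_map]
  filter_upwards [ha, hb] with n h1 h2
  have := avg_sq_add_le (F n) x y
  linarith

theorem SquareAverageable.smul {F : ℕ → Finset G} {x : G → H} (c : ℂ)
    (hx : SquareAverageable F x) : SquareAverageable F (c • x) := by
  obtain ⟨a, ha⟩ := hx
  rw [eventually_map] at ha
  refine ⟨‖c‖ ^ 2 * a, ?_⟩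
  rw [eventually_map]
  filter_upwards [ha] with n h1
  rw [avg_sq_smul]
  exact mul_le_mul_of_nonneg_left h1 (by positivity)

theorem SquareAverageable.zero (F : ℕ → Finset G) : SquareAverageable F (0 : G → H) :=
  ⟨0, by simp [avg]⟩

theorem SquareAverageable.sub {F : ℕ → Finset G} {x y : G → H}
    (hx : SquareAverageable F x) (hy : SquareAverageable F y) : SquareAverageable F (x - y) := by
  have := hx.add (hy.smul (-1))
  rwa [neg_one_smul, ← sub_eq_add_neg] at this

theorem SquareAverageable.comp {F : ℕ → Finset G} {x : G → H} (hx : SquareAverageable F x)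
    {N : ℕ → ℕ} (hN : StrictMono N) : SquareAverageable (fun q => F (N q)) x := by
  obtain ⟨a, ha⟩ := hx
  rw [eventually_map] at ha
  exact ⟨a, by rw [eventually_map]; exact hN.tendsto_atTop.eventually ha⟩

theorem exists_lim_of_approx {A : ℕ → Finset G} {x y : G → H} (hy : SquareAverageable A y)
    (hx : ∀ ε > (0 : ℝ), ∃ x' : G → H,
      (∃ L : ℂ, Tendsto (fun q => avg (A q) (fun g => inner ℂ (x' g) (y g))) atTop (𝓝 L)) ∧
      ∀ᶠ q in atTop, avg (A q) (fun g => ‖(x - x') g‖ ^ 2) < ε) :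
    ∃ L : ℂ, Tendsto (fun q => avg (A q) (fun g => inner ℂ (x g) (y g))) atTop (𝓝 L) := by
  apply cauchySeq_tendsto_of_complete
  obtain ⟨C, hC⟩ := hy
  rw [eventually_map] at hC
  rw [Metric.cauchySeq_iff']
  intro ε hε
  have hδ : 0 < (ε / 4) ^ 2 / (|C| + 1) := by positivity
  obtain ⟨x', ⟨L, hL⟩, hx'⟩ := hx _ hδ
  have hclose : ∀ᶠ q in atTop, dist (avg (A q) (fun g => inner ℂ (x g) (y g))) L < ε / 2 := by
    filter_upwards [hC, hx', Metric.tendsto_nhds.1 hL (ε / 4) (by positivity)] with q h1 h2 h3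
    have e : avg (A q) (fun g => inner ℂ (x g) (y g)) =
        avg (A q) (fun g => inner ℂ ((x - x') g) (y g)) +
          avg (A q) (fun g => inner ℂ (x' g) (y g)) := by
      rw [← avg_inner_add_left, sub_add_cancel]
    have h4 := avg_inner_sq_le (A q) (x - x') y
    have h5 : avg (A q) (fun g => ‖(x - x') g‖ ^ 2) * avg (A q) (fun g => ‖y g‖ ^ 2) ≤
        (ε / 4) ^ 2 / (|C| + 1) * (|C| + 1) :=
      mul_le_mul h2.le (h1.trans ((le_abs_self C).trans (by linarith)))
        (avg_sq_nonneg _ _) hδ.le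
    rw [div_mul_cancel₀ _ (by positivity)] at h5
    have h6 := abs_le_of_sq_le_sq (h4.trans h5) (by positivity)
    rw [dist_eq_norm] at h3 ⊢
    rw [e, add_sub_assoc]
    have h7 := norm_add_le (avg (A q) (fun g => inner ℂ ((x - x') g) (y g)))
      (avg (A q) (fun g => inner ℂ (x' g) (y g)) - L)
    have h8 := (abs_le.1 (h6 : |_| ≤ _)).2
    linarith
  obtain ⟨n, hn⟩ := eventually_atTop.1 hclose
  refine ⟨n, fun m hm => ?_⟩
  have := dist_triangle_right (avg (A m) (fun g => inner ℂ (x g) (y g)))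
    (avg (A n) (fun g => inner ℂ (x g) (y g))) L
  linarith [hn m hm, hn n le_rfl]

end Averages

/-- A permissible pair `((f_i)_{i ∈ I}, (F_{N_q})_q)`: a family of square averageable functions and
a subsequence of `(F_n)` along which all averaged inner products of members of the family
converge. -/
structure PermissiblePair {G H I : Type*} [NormedAddCommGroup H] [InnerProductSpace ℂ H]
    (F : ℕ → Finset G) (f : I → G → H) where
  /-- the indices `N_q` -/
  N : ℕ → ℕ
  strictMono : StrictMono N
  squareAverageable : ∀ i, SquareAverageable F (f i)
  exists_lim : ∀ i j, ∃ L : ℂ,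
    Tendsto (fun q => avg (F (N q)) (fun g => inner ℂ (f i g) (f j g))) atTop (𝓝 L)

namespace PermissiblePair

variable {G H I : Type*} [NormedAddCommGroup H] [InnerProductSpace ℂ H]
  {F : ℕ → Finset G} {f : I → G → H} (P : PermissiblePair F f)

/-- The sets `F_{N_q}`. -/
def sets (q : ℕ) : Finset G := F (P.N q)

/-- The linear span `ℋ'` of the family. -/
def spanF : Submodule ℂ (G → H) := Submodule.span ℂ (Set.range f)

theorem squareAverageable_of_mem_span {x : G → H} (hx : x ∈ spanF (f := f)) :
    SquareAverageable P.sets x := by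
  induction hx using Submodule.span_induction with
  | mem x hx => obtain ⟨i, rfl⟩ := hx; exact (P.squareAverageable i).comp P.strictMono
  | zero => exact SquareAverageable.zero _
  | add x y _ _ hx hy => exact hx.add hy
  | smul c x _ hx => exact hx.smul c

/-- The functions `E` of `ℋ''`: square averageable along `(F_{N_q})`, and approximable by elements
of the span in the mean square sense. -/
def MemPre (E : G → H) : Prop :=
  SquareAverageable P.sets E ∧
    ∀ ε > (0 : ℝ), ∃ E' ∈ spanF (f := f),
      limsup (fun q => avg (P.sets q) (fun g => ‖E g - E' g‖ ^ 2)) atTop < ε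

theorem memPre_iff {E : G → H} : P.MemPre E ↔ SquareAverageable P.sets E ∧
    ∀ ε > (0 : ℝ), ∃ E' ∈ spanF (f := f),
      ∀ᶠ q in atTop, avg (P.sets q) (fun g => ‖(E - E') g‖ ^ 2) < ε := by
  refine and_congr_right fun hE => ⟨fun h ε hε => ?_, fun h ε hε => ?_⟩
  · obtain ⟨E', hE', hl⟩ := h ε hε
    exact ⟨E', hE', eventually_lt_of_limsup_lt hl
      (hE.sub (P.squareAverageable_of_mem_span hE'))⟩
  · obtain ⟨E', hE', hl⟩ := h (ε / 2) (half_pos hε)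
    refine ⟨E', hE', lt_of_le_of_lt (limsup_le_of_le ?_ (hl.mono fun q hq => hq.le))
      (half_lt_self hε)⟩
    exact IsBoundedUnder.isCoboundedUnder_le
      ⟨0, eventually_map.2 (Eventually.of_forall fun q => avg_sq_nonneg (P.sets q) (E - E'))⟩

/-- The space `ℋ''` as a space of functions. -/
def preSubmodule : Submodule ℂ (G → H) where
  carrier := {E | P.MemPre E}
  zero_mem' := (P.memPre_iff).2 ⟨SquareAverageable.zero _, fun ε hε =>
    ⟨0, Submodule.zero_mem _, Eventually.of_forall fun q => by simpa [avg] using hε⟩⟩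
  add_mem' := by
    intro x y hx hy
    rw [Set.mem_ofPred_eq, memPre_iff] at *
    refine ⟨hx.1.add hy.1, fun ε hε => ?_⟩
    obtain ⟨x', hx', h1⟩ := hx.2 (ε / 4) (by positivity)
    obtain ⟨y', hy', h2⟩ := hy.2 (ε / 4) (by positivity)
    refine ⟨x' + y', Submodule.add_mem _ hx' hy', ?_⟩
    filter_upwards [h1, h2] with q h1 h2
    have := avg_sq_add_le (P.sets q) (x - x') (y - y')
    rw [show x + y - (x' + y') = (x - x') + (y - y') by abel]
    linarith
  smul_mem' := by
    intro c x hx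
    rw [Set.mem_ofPred_eq, memPre_iff] at *
    refine ⟨hx.1.smul c, fun ε hε => ?_⟩
    obtain ⟨x', hx', h1⟩ := hx.2 (ε / (‖c‖ ^ 2 + 1)) (by positivity)
    refine ⟨c • x', Submodule.smul_mem _ c hx', ?_⟩
    filter_upwards [h1] with q h1
    rw [← smul_sub, avg_sq_smul]
    rw [lt_div_iff₀ (by positivity)] at h1
    nlinarith [avg_sq_nonneg (P.sets q) (x - x')]

theorem mem_preSubmodule (i : I) : f i ∈ P.preSubmodule :=
  (P.memPre_iff).2 ⟨(P.squareAverageable i).comp P.strictMono, fun ε hε =>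
    ⟨f i, Submodule.subset_span ⟨i, rfl⟩,
      Eventually.of_forall fun q => by simpa [avg] using hε⟩⟩

theorem exists_lim_of_mem_span {x y : G → H} (hx : x ∈ spanF (f := f)) (hy : y ∈ spanF (f := f)) :
    ∃ L : ℂ, Tendsto (fun q => avg (P.sets q) (fun g => inner ℂ (x g) (y g))) atTop (𝓝 L) := by
  induction hx using Submodule.span_induction with
  | zero => exact ⟨0, by simp [avg]⟩
  | add x x' _ _ h h' =>
    obtain ⟨L, hL⟩ := h
    obtain ⟨L', hL'⟩ := h'
    exact ⟨L + L', by simpa only [avg_inner_add_left] using hL.add hL'⟩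
  | smul c x _ h =>
    obtain ⟨L, hL⟩ := h
    exact ⟨(starRingEnd ℂ) c * L, by simpa only [avg_inner_smul_left] using hL.const_mul _⟩
  | mem x hx =>
    obtain ⟨i, rfl⟩ := hx
    suffices h : ∃ L : ℂ, Tendsto (fun q => avg (P.sets q) (fun g => inner ℂ (y g) (f i g)))
        atTop (𝓝 L) by
      obtain ⟨L, hL⟩ := h
      exact ⟨(starRingEnd ℂ) L, by
        simpa only [Function.comp_def, avg_inner_conj] using
      (Complex.continuous_conj.tendsto L).comp hL⟩
    induction hy using Submodule.span_induction with
    | zero => exact ⟨0, by simp [avg]⟩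
    | add x x' _ _ h h' =>
      obtain ⟨L, hL⟩ := h
      obtain ⟨L', hL'⟩ := h'
      exact ⟨L + L', by simpa only [avg_inner_add_left] using hL.add hL'⟩
    | smul c x _ h =>
      obtain ⟨L, hL⟩ := h
      exact ⟨(starRingEnd ℂ) c * L, by simpa only [avg_inner_smul_left] using hL.const_mul _⟩
    | mem y hy => obtain ⟨j, rfl⟩ := hy; exact P.exists_lim j i

theorem exists_lim_of_mem {x y : G → H} (hx : x ∈ P.preSubmodule) (hy : y ∈ P.preSubmodule) :
    ∃ L : ℂ, Tendsto (fun q => avg (P.sets q) (fun g => inner ℂ (x g) (y g))) atTop (𝓝 L) := by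
  have hx := P.memPre_iff.1 hx
  have hy := P.memPre_iff.1 hy
  refine exists_lim_of_approx hy.1 fun ε hε => ?_
  obtain ⟨x', hx', h1⟩ := hx.2 ε hε
  refine ⟨x', ?_, h1⟩
  have h : ∃ L : ℂ, Tendsto (fun q => avg (P.sets q) (fun g => inner ℂ (y g) (x' g)))
      atTop (𝓝 L) := by
    refine exists_lim_of_approx (P.squareAverageable_of_mem_span hx') fun δ hδ => ?_
    obtain ⟨y', hy', h2⟩ := hy.2 δ hδ
    exact ⟨y', P.exists_lim_of_mem_span hy' hx', h2⟩
  obtain ⟨L, hL⟩ := h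
  exact ⟨(starRingEnd ℂ) L, by
    simpa only [Function.comp_def, avg_inner_conj] using
      (Complex.continuous_conj.tendsto L).comp hL⟩

/-- The space `ℋ''`, as a type that carries no topology from the product `G → H`. -/
def Pre : Type _ := P.preSubmodule

instance : AddCommGroup P.Pre := inferInstanceAs (AddCommGroup P.preSubmodule)

instance : Module ℂ P.Pre := inferInstanceAs (Module ℂ P.preSubmodule)

/-- An element of `ℋ''` from a function that belongs to it. -/
def Pre.mk {P : PermissiblePair F f} (x : G → H) (hx : x ∈ P.preSubmodule) : P.Pre :=
  (⟨x, hx⟩ : P.preSubmodule)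

/-- The function `G → H` underlying an element of `ℋ''`. -/
def Pre.toFun {P : PermissiblePair F f} (x : P.Pre) : G → H :=
  Subtype.val (p := (· ∈ P.preSubmodule)) x

/-- The form `⟨x, y⟩_ℋ = lim_q (1/|F_{N_q}|) ∑_{g ∈ F_{N_q}} ⟨x g, y g⟩` on `ℋ''`. -/
def preInner (x y : P.Pre) : ℂ :=
  limUnder atTop (fun q => avg (P.sets q) (fun g => inner ℂ (x.toFun g) (y.toFun g)))

theorem tendsto_preInner (x y : P.Pre) :
    Tendsto (fun q => avg (P.sets q) (fun g => inner ℂ (x.toFun g) (y.toFun g))) atTop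
      (𝓝 (P.preInner x y)) :=
  tendsto_nhds_limUnder (P.exists_lim_of_mem x.2 y.2)

/-- `⟨·,·⟩_ℋ` is a positive semidefinite Hermitian form on `ℋ''`. -/
@[reducible]
def preCore : PreInnerProductSpace.Core ℂ P.Pre where
  inner := P.preInner
  conj_inner_symm x y := by
    refine tendsto_nhds_unique ?_ (P.tendsto_preInner x y)
    simpa only [Function.comp_def, avg_inner_conj] using
      (Complex.continuous_conj.tendsto _).comp (P.tendsto_preInner y x)
  re_inner_nonneg x := by
    refine ge_of_tendsto ((Complex.continuous_re.tendsto _).comp (P.tendsto_preInner x x))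
      (Eventually.of_forall fun q => ?_)
    simp only [Function.comp_apply, avg_inner_self, Complex.ofReal_re]
    exact avg_sq_nonneg _ _
  add_left x y z := by
    refine tendsto_nhds_unique (P.tendsto_preInner (x + y) z) ?_
    have h := (P.tendsto_preInner x z).add (P.tendsto_preInner y z)
    simp only [← avg_inner_add_left] at h
    exact h
  smul_left x y c := by
    refine tendsto_nhds_unique (P.tendsto_preInner (c • x) y) ?_
    have h := (P.tendsto_preInner x y).const_mul ((starRingEnd ℂ) c)
    simp only [← avg_inner_smul_left] at h
    exact h

instance : SeminormedAddCommGroup P.Pre :=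
  @InnerProductSpace.Core.toSeminormedAddCommGroup ℂ P.Pre _ _ _ P.preCore

instance : InnerProductSpace ℂ P.Pre := InnerProductSpace.ofCore P.preCore

/-- The space `ℋ = ℋ'' / S` induced by the permissible pair, `S` being the null space of the
seminorm `‖x‖² = lim_q (1/|F_{N_q}|) ∑_{g ∈ F_{N_q}} ‖x g‖²`. -/
abbrev Space : Type _ := SeparationQuotient P.Pre

/-- The class in `ℋ` of an element of `ℋ''`. -/
def toSpace (x : P.Pre) : P.Space := SeparationQuotient.mk x

theorem inner_toSpace (x y : P.Pre) : inner ℂ (P.toSpace x) (P.toSpace y) = P.preInner x y := rfl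

/-- The subspace divided out consists of the `x` with `lim_q (1/|F_{N_q}|) ∑_{g ∈ F_{N_q}} ‖x g‖² = 0`. -/
theorem toSpace_eq_zero_iff (x : P.Pre) : P.toSpace x = 0 ↔
    Tendsto (fun q => avg (P.sets q) (fun g => ‖x.toFun g‖ ^ 2)) atTop (𝓝 0) := by
  have h := P.tendsto_preInner x x
  simp only [avg_inner_self] at h
  rw [← inner_self_eq_zero (𝕜 := ℂ), inner_toSpace]
  constructor
  · intro h0
    rw [h0] at h
    simpa [Function.comp_def] using (Complex.continuous_re.tendsto _).comp h
  · intro h0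
    exact tendsto_nhds_unique h (by
      simpa [Function.comp_def] using (Complex.continuous_ofReal.tendsto 0).comp h0)

/-- The class in `ℋ` of the member `f i` of the family. -/
def cls (i : I) : P.Space := P.toSpace (Pre.mk (f i) (P.mem_preSubmodule i))

end PermissiblePair

section Representations

/-- `π` is unitarily equivalent to a subrepresentation of `ρ`, i.e. to the restriction of `ρ` to a
closed invariant subspace. -/
def EquivSubrepresentation {G E E' : Type*} [Group G]
    [NormedAddCommGroup E] [InnerProductSpace ℂ E] [NormedAddCommGroup E'] [InnerProductSpace ℂ E']
    (π : G →* (E ≃ₗᵢ[ℂ] E)) (ρ : G →* (E' ≃ₗᵢ[ℂ] E')) : Prop :=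
  ∃ K : Submodule ℂ E', IsClosed (K : Set E') ∧ (∀ g, ∀ x ∈ K, ρ g x ∈ K) ∧
    ∃ Φ : E ≃ₗᵢ[ℂ] K, ∀ g x, (Φ (π g x) : E') = ρ g (Φ x)

variable (G : Type*) [Group G]

/-- `ℓ²(G)` -/
abbrev L2 : Type _ := lp (fun _ : G => ℂ) 2

variable {G}

theorem memlp_leftTranslate (g : G) (x : L2 G) : Memℓp (fun k => x (g⁻¹ * k)) 2 := by
  have h := (memℓp_gen_iff (p := 2) (by norm_num)).1 x.2
  exact (memℓp_gen_iff (p := 2) (by norm_num)).2 ((Equiv.mulLeft g⁻¹).summable_iff.2 h)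

/-- `(L_g x)(k) = x (g⁻¹ k)` on `ℓ²(G)`. -/
def leftTranslate (g : G) (x : L2 G) : L2 G := ⟨fun k => x (g⁻¹ * k), memlp_leftTranslate g x⟩

@[simp]
theorem leftTranslate_apply (g : G) (x : L2 G) (k : G) : leftTranslate g x k = x (g⁻¹ * k) := rfl

/-- `L_g` as a unitary operator of `ℓ²(G)`. -/
def leftTranslateIsometry (g : G) : L2 G ≃ₗᵢ[ℂ] L2 G where
  toFun := leftTranslate g
  invFun := leftTranslate g⁻¹
  left_inv x := by ext k; simp
  right_inv x := by ext k; simp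
  map_add' x y := by ext k; simp
  map_smul' c x := by ext k; simp
  norm_map' x := by
    change ‖leftTranslate g x‖ = ‖x‖
    rw [lp.norm_eq_tsum_rpow (p := 2) (by norm_num), lp.norm_eq_tsum_rpow (p := 2) (by norm_num)]
    congr 1
    exact (Equiv.mulLeft g⁻¹).tsum_eq (fun k => ‖x k‖ ^ (2 : ENNReal).toReal)

variable (G) in
/-- The left regular representation of `G` on `ℓ²(G)`. -/
def leftRegular : G →* (L2 G ≃ₗᵢ[ℂ] L2 G) where
  toFun := leftTranslateIsometry
  map_one' := by
    refine LinearIsometryEquiv.ext fun x => ?_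
    ext k
    change x (1⁻¹ * k) = x k
    simp
  map_mul' g h := by
    refine LinearIsometryEquiv.ext fun x => ?_
    ext k
    change x ((g * h)⁻¹ * k) = x (h⁻¹ * (g⁻¹ * k))
    simp [mul_assoc]

variable {H : Type*} [NormedAddCommGroup H] [InnerProductSpace ℂ H]

/-- `(U_h u)(g) = u (g h)`. -/
def translate (h : G) (u : G → H) : G → H := fun g => u (g * h)

/-- `U` is the unitary representation induced on `ℋ` by the translations: `U_g` sends the class of
`U_h u` to the class of `U_g U_h u = U_{gh} u`. (The classes of the `U_h u` span a dense subspace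
of `ℋ`, so this determines `U`.) -/
def IsInducedRep {F : ℕ → Finset G} {u : G → H}
    (P : PermissiblePair F (fun h : G => translate h u))
    (U : G →* (P.Space ≃ₗᵢ[ℂ] P.Space)) : Prop :=
  ∀ g h, U g (P.cls h) = P.cls (g * h)

/-- `u` is spectrally Lebesgue: for every permissible pair `((U_h u)_{h ∈ G}, (F_{N_q})_q)`, the
translations induce a (unique) unitary representation on `ℋ`, and it is equivalent to a
subrepresentation of the left regular representation. -/
def SpectrallyLebesgue (F : ℕ → Finset G) (u : G → H) : Prop :=
  ∀ P : PermissiblePair F (fun h : G => translate h u),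
    (∃! U : G →* (P.Space ≃ₗᵢ[ℂ] P.Space), IsInducedRep P U) ∧
    ∀ U : G →* (P.Space ≃ₗᵢ[ℂ] P.Space), IsInducedRep P U →
      EquivSubrepresentation U (leftRegular G)

end Representations

end

end VdC

/-!
Averages along a right-Følner sequence are asymptotically invariant under right translation, so the
Gram matrix of the classes of the `U_h u` in `ℋ` is invariant under left multiplication of the
indices; as these classes span a dense subspace and `ℋ` is complete, this yields the unique
representation `U`. For infinite `G`, completeness comes from `|F_N| → ∞`: the members of a summable
sequence can be changed on finite sets, which averages do not see, until their pointwise sum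
represents the sum in `ℋ`.

The class `v` of `u` is cyclic for `U` and `∑_g |⟨v, U_g v⟩|²` is finite. The operator `A` sending
`x` to `g ↦ ⟨U_g v, x⟩` is therefore a densely defined, closed and injective intertwiner from `U`
to the left regular representation. Projecting onto its graph produces the bounded injective
intertwiner `A(1 + A*A)⁻¹`, whose polar decomposition provides an isometric one.
-/

namespace VdC

noncomputable section

section Folner

open scoped Pointwise

variable {G : Type*}

theorem norm_sum_sub_sum_le_card_symmDiff [DecidableEq G] {E : Type*} [SeminormedAddCommGroup E]
    {C : ℝ} {φ : G → E} (hφ : ∀ x, ‖φ x‖ ≤ C) (A B : Finset G) :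
    ‖∑ x ∈ A, φ x - ∑ x ∈ B, φ x‖ ≤ C * (symmDiff A B).card := by
  have norm_sum_le_card (S : Finset G) : ‖∑ x ∈ S, φ x‖ ≤ S.card * C := by
    simpa only [Finset.sum_const, nsmul_eq_mul] using norm_sum_le_of_le S fun x _ => hφ x
  have hcard : ((symmDiff A B).card : ℝ) = (A \ B).card + (B \ A).card := by
    rw [symmDiff_def, Finset.sup_eq_union, Finset.card_union_of_disjoint disjoint_sdiff_sdiff,
      Nat.cast_add]
  rw [← Finset.sum_sdiff_sub_sum_sdiff, hcard]
  linarith [norm_sub_le (∑ x ∈ A \ B, φ x) (∑ x ∈ B \ A, φ x), norm_sum_le_card (A \ B),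
    norm_sum_le_card (B \ A)]

variable [Group G] {F : ℕ → Finset G}

theorem IsRightFolner.tendsto_card_symmDiff [DecidableEq G] (hF : IsRightFolner F) (g : G) :
    Tendsto (fun n => ((symmDiff (F n) ((F n).image (· * g))).card : ℝ) / (F n).card) atTop
      (𝓝 0) := by
  refine (hF.2 g).congr fun n => ?_
  rw [← Finset.coe_image, ← Finset.coe_symmDiff, Set.ncard_coe_finset]

theorem IsRightFolner.tendsto_avg_mul_right_sub (hF : IsRightFolner F) {E : Type*}
    [SeminormedAddCommGroup E] [NormedSpace ℝ E] {C : ℝ} {φ : G → E} (hφ : ∀ x, ‖φ x‖ ≤ C) (g : G) :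
    Tendsto (fun n => avg (F n) (fun x => φ (x * g)) - avg (F n) φ) atTop (𝓝 0) := by
  classical
  refine squeeze_zero_norm (fun n => ?_)
    (by simpa only [mul_zero] using (hF.tendsto_card_symmDiff g).const_mul C)
  have himage : ∑ x ∈ F n, φ (x * g) = ∑ x ∈ (F n).image (· * g), φ x :=
    (Finset.sum_image (mul_left_injective g).injOn).symm
  have hbound := norm_sum_sub_sum_le_card_symmDiff hφ ((F n).image (· * g)) (F n)
  rw [avg, avg, ← smul_sub, himage, norm_smul, norm_inv, Real.norm_natCast, inv_mul_eq_div,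
    ← mul_div_assoc, symmDiff_comm]
  gcongr

theorem IsRightFolner.eventually_mem_inv_mul [DecidableEq G] (hF : IsRightFolner F) (g : G) :
    ∀ᶠ n in atTop, g ∈ (F n)⁻¹ * F n := by
  filter_upwards [(hF.tendsto_card_symmDiff g).eventually_lt_const one_pos] with n hn
  have hpos : (0 : ℝ) < (F n).card := mod_cast (hF.1 n).card_pos
  have hlt : (symmDiff (F n) ((F n).image (· * g))).card < (F n).card := by
    exact_mod_cast (div_lt_one hpos).1 hn
  have hmeet : ¬ Disjoint (F n) ((F n).image (· * g)) := fun hdisj => by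
    rw [hdisj.symmDiff_eq_sup] at hlt
    exact hlt.not_ge (Finset.card_le_card Finset.subset_union_left)
  obtain ⟨y, hy, hy'⟩ := Finset.not_disjoint_iff.1 hmeet
  obtain ⟨x, hx, rfl⟩ := Finset.mem_image.1 hy'
  exact Finset.mem_mul.2 ⟨x⁻¹, Finset.inv_mem_inv hx, x * g, hy, inv_mul_cancel_left x g⟩

theorem IsRightFolner.tendsto_card [Infinite G] (hF : IsRightFolner F) :
    Tendsto (fun n => (F n).card) atTop atTop := by
  classical
  refine tendsto_atTop.2 fun M => ?_
  obtain ⟨S, hS⟩ := Infinite.exists_subset_card_eq G (M * M)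
  filter_upwards [(Finset.eventually_all S).2 fun g _ => hF.eventually_mem_inv_mul g] with n hn
  refine Nat.mul_self_le_mul_self_iff.1 ?_
  calc M * M = S.card := hS.symm
    _ ≤ ((F n)⁻¹ * F n).card := Finset.card_le_card hn
    _ ≤ (F n)⁻¹.card * (F n).card := Finset.card_mul_le
    _ = (F n).card * (F n).card := by rw [Finset.card_inv]

end Folner

section RootMeanSquare

variable {G H : Type*} [SeminormedAddCommGroup H] {A : Finset G} {x y : G → H}

/-- The root mean square `(1/|A| ∑_{g ∈ A} ‖x g‖²)^{1/2}`: the seminorm whose limit along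
`(F_{N_q})` is the norm of `ℋ`. -/
def rms (A : Finset G) (x : G → H) : ℝ := √(avg A fun g => ‖x g‖ ^ 2)

theorem rms_nonneg (A : Finset G) (x : G → H) : 0 ≤ rms A x := Real.sqrt_nonneg _

theorem rms_eq_norm_toLp (A : Finset G) (x : G → H) :
    rms A x = √((A.card : ℝ)⁻¹) * ‖WithLp.toLp 2 fun g : A => x g‖ := by
  rw [rms, avg, smul_eq_mul, Real.sqrt_mul (by positivity), PiLp.norm_eq_of_L2,
    ← Finset.sum_coe_sort]

theorem rms_zero (A : Finset G) : rms A (0 : G → H) = 0 := by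
  simp [rms, avg]

theorem rms_add_le (A : Finset G) (x y : G → H) : rms A (x + y) ≤ rms A x + rms A y := by
  simp only [rms_eq_norm_toLp, ← mul_add]
  exact mul_le_mul_of_nonneg_left
    (norm_add_le (WithLp.toLp 2 fun g : A => x g) (WithLp.toLp 2 fun g : A => y g))
    (Real.sqrt_nonneg _)

theorem rms_sum_le {ι : Type*} (A : Finset G) (s : Finset ι) (x : ι → G → H) :
    rms A (∑ i ∈ s, x i) ≤ ∑ i ∈ s, rms A (x i) := by
  apply Finset.le_sum_of_subadditive
  exacts [(rms_zero A).le, rms_add_le A]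

theorem rms_mono (h : ∀ g ∈ A, ‖x g‖ ≤ ‖y g‖) : rms A x ≤ rms A y := by
  refine Real.sqrt_le_sqrt (mul_le_mul_of_nonneg_left (Finset.sum_le_sum fun g hg => ?_)
    (by positivity))
  gcongr
  exact h g hg

theorem rms_congr (h : ∀ g ∈ A, x g = y g) : rms A x = rms A y :=
  le_antisymm (rms_mono fun g hg => (congrArg norm (h g hg)).le)
    (rms_mono fun g hg => (congrArg norm (h g hg)).ge)

theorem tendsto_rms_of_support_finite {A : ℕ → Finset G}
    (hA : Tendsto (fun q => (A q).card) atTop atTop) (hx : x.support.Finite) :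
    Tendsto (fun q => rms (A q) x) atTop (𝓝 0) := by
  have hsum_le q : ∑ g ∈ A q, ‖x g‖ ^ 2 ≤ ∑ g ∈ hx.toFinset, ‖x g‖ ^ 2 := by
    classical
    rw [← Finset.sum_filter_of_ne (p := (· ∈ hx.toFinset)) fun g _ hg =>
      hx.mem_toFinset.2 fun h => hg (by simp [h])]
    exact Finset.sum_le_sum_of_subset_of_nonneg (fun g hg => (Finset.mem_filter.1 hg).2)
      fun _ _ _ => sq_nonneg _
  have hinv : Tendsto (fun q => ((A q).card : ℝ)⁻¹) atTop (𝓝 0) :=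
    tendsto_inv_atTop_zero.comp (tendsto_natCast_atTop_atTop.comp hA)
  have havg : Tendsto (fun q => avg (A q) fun g => ‖x g‖ ^ 2) atTop (𝓝 0) :=
    squeeze_zero (fun q => smul_nonneg (by positivity) (by positivity))
      (fun q => mul_le_mul_of_nonneg_left (hsum_le q) (by positivity))
      (by simpa only [zero_mul] using hinv.mul_const (∑ g ∈ hx.toFinset, ‖x g‖ ^ 2))
  simpa only [rms, Real.sqrt_zero] using havg.sqrt

end RootMeanSquare

section Truncation

variable {G H : Type*} [SeminormedAddCommGroup H] {A : ℕ → Finset G} {x y : ℕ → G → H}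
  {c : ℕ → ℝ}

theorem exists_truncation (hx : ∀ k, ∀ᶠ q in atTop, rms (A q) (x k) ≤ c k) :
    ∃ y : ℕ → G → H, (∀ k, (x k - y k).support.Finite) ∧ (∀ k q, rms (A q) (y k) ≤ c k) ∧
      ∀ q, ∀ g ∈ A q, ∀ k > q, y k g = 0 := by
  classical
  choose N hN using fun k => eventually_atTop.1 ((hx k).and (eventually_ge_atTop k))
  have hkN k : k ≤ N k := (hN k _ le_rfl).2
  let S k : Set G := ⋃ p ∈ Set.Iio (N k), A p
  have hS k : (S k).Finite := (Set.finite_Iio (N k)).biUnion fun p _ => (A p).finite_toSet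
  have hy_zero {k q : ℕ} (hq : q < N k) : ∀ g ∈ A q, (S k)ᶜ.indicator (x k) g = 0 := fun g hg =>
    Set.indicator_of_notMem (Set.notMem_compl_iff.2 (Set.mem_biUnion (Set.mem_Iio.2 hq) hg)) _
  refine ⟨fun k => (S k)ᶜ.indicator (x k), fun k => (hS k).subset ?_, fun k q => ?_,
    fun q g hg k hk => hy_zero (hk.trans_le (hkN k)) g hg⟩
  · intro g hg
    by_contra hgS
    exact hg (sub_eq_zero.2 (Set.indicator_of_mem (Set.mem_compl hgS) (x k)).symm)
  · rcases lt_or_ge q (N k) with hq | hq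
    · rw [rms_congr (y := 0) (hy_zero hq), rms_zero]
      exact (rms_nonneg _ _).trans (hN k _ le_rfl).1
    · exact (rms_mono fun g _ => norm_indicator_le_norm_self _ _).trans (hN k q hq).1

theorem exists_rms_sub_sum_le_tsum (hc : Summable c) (hy : ∀ k q, rms (A q) (y k) ≤ c k)
    (hy_zero : ∀ q, ∀ g ∈ A q, ∀ k > q, y k g = 0) :
    ∃ z : G → H, ∀ n q, rms (A q) (z - ∑ k ∈ Finset.range n, y k) ≤ ∑' k, c (k + n) := by
  refine ⟨fun g => ∑ᶠ k, y k g, fun n q => ?_⟩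
  have htail : ∀ g ∈ A q, ((fun g => ∑ᶠ k, y k g) - ∑ k ∈ Finset.range n, y k) g =
      (∑ k ∈ Finset.range (q + 1), y (k + n)) g := fun g hg => by
    have hsupp : (fun k => y k g).support ⊆ Finset.range (n + (q + 1)) := fun k hk => by
      by_contra hlt
      rw [Finset.coe_range, Set.mem_Iio] at hlt
      exact hk (hy_zero q g hg k (by omega))
    simp only [Pi.sub_apply, Finset.sum_apply, finsum_eq_sum_of_support_subset _ hsupp,
      Finset.sum_range_add, add_sub_cancel_left, add_comm]
  have hc_tail : Summable fun k => c (k + n) := (summable_nat_add_iff n).2 hc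
  calc rms (A q) ((fun g => ∑ᶠ k, y k g) - ∑ k ∈ Finset.range n, y k)
      = rms (A q) (∑ k ∈ Finset.range (q + 1), y (k + n)) := rms_congr htail
    _ ≤ ∑ k ∈ Finset.range (q + 1), rms (A q) (y (k + n)) := rms_sum_le _ _ _
    _ ≤ ∑ k ∈ Finset.range (q + 1), c (k + n) := Finset.sum_le_sum fun k _ => hy _ q
    _ ≤ ∑' k, c (k + n) :=
      hc_tail.sum_le_tsum _ fun k _ => (rms_nonneg _ _).trans (hy (k + n) q)

theorem exists_eventually_rms_sub_sum_le (hA : Tendsto (fun q => (A q).card) atTop atTop)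
    (hc : Summable c) (hx : ∀ k, ∀ᶠ q in atTop, rms (A q) (x k) ≤ c k) :
    ∃ z : G → H, ∀ n, ∀ ε > 0, ∀ᶠ q in atTop,
      rms (A q) (z - ∑ k ∈ Finset.range n, x k) ≤ ∑' k, c (k + n) + ε := by
  obtain ⟨y, hxy, hy, hy_zero⟩ := exists_truncation hx
  obtain ⟨z, hz⟩ := exists_rms_sub_sum_le_tsum hc hy hy_zero
  refine ⟨z, fun n ε hε => ?_⟩
  have herror : Tendsto (fun q => rms (A q) (∑ k ∈ Finset.range n, (y k - x k))) atTop (𝓝 0) := by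
    refine squeeze_zero (fun q => rms_nonneg _ _) (fun q => rms_sum_le _ _ _) ?_
    simpa only [Finset.sum_const_zero] using tendsto_finsetSum (Finset.range n) fun k _ =>
      tendsto_rms_of_support_finite hA (x := y k - x k)
        (by simpa only [← neg_sub (x k), Function.support_neg] using hxy k)
  filter_upwards [herror.eventually_lt_const hε] with q hq
  have hsplit : z - ∑ k ∈ Finset.range n, x k =
      (z - ∑ k ∈ Finset.range n, y k) + ∑ k ∈ Finset.range n, (y k - x k) := by
    rw [Finset.sum_sub_distrib, sub_add_sub_cancel]
  rw [hsplit]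
  exact (rms_add_le _ _ _).trans (add_le_add (hz n q) hq.le)

end Truncation

namespace PermissiblePair

variable {G H I : Type*} [NormedAddCommGroup H] [InnerProductSpace ℂ H]
  {F : ℕ → Finset G} {f : I → G → H} (P : PermissiblePair F f)

theorem tendsto_rms (x : P.Pre) : Tendsto (fun q => rms (P.sets q) x.toFun) atTop (𝓝 ‖x‖) := by
  have hsq := (Complex.continuous_re.tendsto _).comp (P.tendsto_preInner x x)
  simp only [Function.comp_def, avg_inner_self, Complex.ofReal_re] at hsq
  exact hsq.sqrt

theorem exists_mem_spanF_rms_sub_lt {x : G → H} (hx : x ∈ P.preSubmodule) {ε : ℝ} (hε : 0 < ε) :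
    ∃ x' ∈ spanF (f := f), ∀ᶠ q in atTop, rms (P.sets q) (x - x') < ε := by
  obtain ⟨x', hx', hlt⟩ := (P.memPre_iff.1 hx).2 (ε ^ 2) (by positivity)
  exact ⟨x', hx', hlt.mono fun q hq => (Real.sqrt_lt' hε).2 hq⟩

theorem mem_preSubmodule_of_rms_sub_lt {z : G → H}
    (hz : ∀ ε > 0, ∃ x ∈ P.preSubmodule, ∀ᶠ q in atTop, rms (P.sets q) (z - x) < ε) :
    z ∈ P.preSubmodule := by
  refine P.memPre_iff.2 ⟨?_, fun ε hε => ?_⟩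
  · obtain ⟨x, hx, hzx⟩ := hz 1 one_pos
    have hsub : SquareAverageable P.sets (z - x) :=
      ⟨1 ^ 2, eventually_map.2 (hzx.mono fun q hq => ((Real.sqrt_lt' one_pos).1 hq).le)⟩
    simpa only [sub_add_cancel] using hsub.add (P.memPre_iff.1 hx).1
  · have hδ : 0 < √ε / 2 := half_pos (Real.sqrt_pos.2 hε)
    obtain ⟨x, hx, hzx⟩ := hz _ hδ
    obtain ⟨x', hx', hxx'⟩ := P.exists_mem_spanF_rms_sub_lt hx hδ
    refine ⟨x', hx', ?_⟩
    filter_upwards [hzx, hxx'] with q hzx hxx'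
    refine lt_of_not_ge fun hge => (Real.sqrt_le_sqrt hge).not_gt ?_
    calc rms (P.sets q) (z - x')
        = rms (P.sets q) ((z - x) + (x - x')) := by rw [sub_add_sub_cancel]
      _ ≤ rms (P.sets q) (z - x) + rms (P.sets q) (x - x') := rms_add_le _ _ _
      _ < √ε := by linarith

theorem exists_tendsto_sum_of_summable_norm (hA : Tendsto (fun q => (P.sets q).card) atTop atTop)
    {x : ℕ → P.Pre} (hx : Summable fun k => ‖x k‖) :
    ∃ z, Tendsto (fun n => ∑ k ∈ Finset.range n, x k) atTop (𝓝 z) := by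
  let c (k : ℕ) : ℝ := ‖x k‖ + (1 / 2) ^ k
  have hc : Summable c := hx.add summable_geometric_two
  have hc_tail : Tendsto (fun n => ∑' k, c (k + n)) atTop (𝓝 0) := tendsto_sum_nat_add c
  have hxc k : ∀ᶠ q in atTop, rms (P.sets q) (x k).toFun ≤ c k :=
    ((P.tendsto_rms (x k)).eventually_lt_const (lt_add_of_pos_right _ (by positivity))).mono
      fun q hq => hq.le
  have toFun_sum n : (∑ k ∈ Finset.range n, x k).toFun = ∑ k ∈ Finset.range n, (x k).toFun :=
    map_sum P.preSubmodule.subtype x (Finset.range n)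
  obtain ⟨z, hz⟩ := exists_eventually_rms_sub_sum_le hA hc hxc
  simp only [← toFun_sum] at hz
  have hz_mem : z ∈ P.preSubmodule := P.mem_preSubmodule_of_rms_sub_lt fun ε hε => by
    obtain ⟨n, hn⟩ := (hc_tail.eventually_lt_const (half_pos hε)).exists
    exact ⟨_, (∑ k ∈ Finset.range n, x k).2, (hz n _ (half_pos hε)).mono
      fun q hq => hq.trans_lt (by linarith)⟩
  have hnorm n : ‖Pre.mk z hz_mem - ∑ k ∈ Finset.range n, x k‖ ≤ ∑' k, c (k + n) :=
    le_of_forall_pos_le_add fun ε hε => le_of_tendsto (P.tendsto_rms _) (hz n ε hε)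
  refine ⟨.mk z hz_mem, tendsto_iff_norm_sub_tendsto_zero.2 ?_⟩
  simpa only [norm_sub_rev] using squeeze_zero (fun n => norm_nonneg _) hnorm hc_tail

theorem completeSpace_space (hA : Tendsto (fun q => (P.sets q).card) atTop atTop) :
    CompleteSpace P.Space := by
  refine NormedAddCommGroup.completeSpace_of_summable_imp_tendsto fun u hu => ?_
  choose x hx using fun k => SeparationQuotient.surjective_mk (u k)
  obtain rfl : u = fun k => P.toSpace (x k) := funext fun k => (hx k).symm
  obtain ⟨z, hz⟩ := P.exists_tendsto_sum_of_summable_norm hA (x := x) hu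
  have toSpace_sum n : ∑ k ∈ Finset.range n, P.toSpace (x k) =
      P.toSpace (∑ k ∈ Finset.range n, x k) :=
    (map_sum SeparationQuotient.mkAddMonoidHom x _).symm
  simp only [toSpace_sum]
  exact ⟨P.toSpace z, (SeparationQuotient.continuous_mk.tendsto z).comp hz⟩

theorem spanF_le_preSubmodule : spanF (f := f) ≤ P.preSubmodule :=
  Submodule.span_le.2 (by rintro _ ⟨i, rfl⟩; exact P.mem_preSubmodule i)

theorem toSpace_mem_span_cls {x : G → H} (hx : x ∈ spanF (f := f)) :
    P.toSpace (.mk x (P.spanF_le_preSubmodule hx)) ∈ Submodule.span ℂ (Set.range P.cls) := by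
  induction hx using Submodule.span_induction with
  | mem x hx => obtain ⟨i, rfl⟩ := hx; exact Submodule.subset_span ⟨i, rfl⟩
  | zero => exact Submodule.zero_mem _
  | add x y _ _ hx hy => exact Submodule.add_mem _ hx hy
  | smul c x _ hx => exact Submodule.smul_mem _ c hx

theorem dense_span_cls : Dense (Submodule.span ℂ (Set.range P.cls) : Set P.Space) := by
  intro z
  obtain ⟨x, rfl⟩ := SeparationQuotient.surjective_mk z
  refine Metric.mem_closure_iff.2 fun ε hε => ?_
  obtain ⟨x', hx', hlt⟩ := P.exists_mem_spanF_rms_sub_lt x.2 (half_pos hε)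
  refine ⟨_, P.toSpace_mem_span_cls hx', ?_⟩
  have hle : ‖x - .mk x' (P.spanF_le_preSubmodule hx')‖ ≤ ε / 2 :=
    le_of_tendsto (P.tendsto_rms _) (hlt.mono fun q hq => hq.le)
  calc dist (P.toSpace x) (P.toSpace (.mk x' (P.spanF_le_preSubmodule hx')))
      = ‖x - .mk x' (P.spanF_le_preSubmodule hx')‖ := dist_eq_norm x _
    _ < ε := hle.trans_lt (half_lt_self hε)

theorem completeSpace_space_of_finite [Finite I] : CompleteSpace P.Space := by
  have hspan : (Submodule.span ℂ (Set.range P.cls)).FG :=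
    Submodule.fg_span (Set.finite_range P.cls)
  have := Module.Finite.of_fg hspan
  have htop : Submodule.span ℂ (Set.range P.cls) = ⊤ :=
    SetLike.coe_injective ((Submodule.closed_of_finiteDimensional _).closure_eq.symm.trans
      P.dense_span_cls.closure_eq)
  have : FiniteDimensional ℂ P.Space := ⟨htop ▸ hspan⟩
  exact FiniteDimensional.complete ℂ P.Space

end PermissiblePair

section GramMatrix

theorem denseRange_linearCombination {R M ι : Type*} [Semiring R] [AddCommMonoid M] [Module R M]
    [TopologicalSpace M] {v : ι → M} (hv : Dense (Submodule.span R (Set.range v) : Set M)) :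
    DenseRange (Finsupp.linearCombination R v) := by
  rwa [DenseRange, ← LinearMap.coe_range, Finsupp.range_linearCombination]

variable {𝕜 ι E E' : Type*} [RCLike 𝕜] [NormedAddCommGroup E] [InnerProductSpace 𝕜 E]
  [NormedAddCommGroup E'] [InnerProductSpace 𝕜 E'] {v : ι → E} {w : ι → E'}

theorem norm_linearCombination_eq_of_inner_eq
    (h : ∀ i j, inner 𝕜 (w i) (w j) = inner 𝕜 (v i) (v j)) (c : ι →₀ 𝕜) :
    ‖Finsupp.linearCombination 𝕜 w c‖ = ‖Finsupp.linearCombination 𝕜 v c‖ := by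
  rw [norm_eq_sqrt_re_inner (𝕜 := 𝕜), norm_eq_sqrt_re_inner (𝕜 := 𝕜)]
  simp only [Finsupp.linearCombination_apply, Finsupp.sum, sum_inner, inner_sum,
    inner_smul_left, inner_smul_right, h]

theorem exists_linearIsometryEquiv_of_inner_eq [CompleteSpace E] [CompleteSpace E']
    (hv : Dense (Submodule.span 𝕜 (Set.range v) : Set E))
    (hw : Dense (Submodule.span 𝕜 (Set.range w) : Set E'))
    (h : ∀ i j, inner 𝕜 (w i) (w j) = inner 𝕜 (v i) (v j)) :
    ∃ T : E ≃ₗᵢ[𝕜] E', ∀ i, T (v i) = w i := by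
  have hv := denseRange_linearCombination hv
  have hw := denseRange_linearCombination hw
  have hnorm := norm_linearCombination_eq_of_inner_eq h
  refine ⟨(LinearEquiv.refl 𝕜 (ι →₀ 𝕜)).extendOfIsometry _ _ hv hw hnorm, fun i => ?_⟩
  simpa using
    (LinearEquiv.refl 𝕜 (ι →₀ 𝕜)).extendOfIsometry_eq _ _ hv hw hnorm (Finsupp.single i 1)

theorem linearIsometryEquiv_ext_of_dense_span
    (hv : Dense (Submodule.span 𝕜 (Set.range v) : Set E)) {S T : E ≃ₗᵢ[𝕜] E'}
    (h : ∀ i, S (v i) = T (v i)) : S = T := by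
  have heq : (S.toContinuousLinearEquiv : E →L[𝕜] E') = T.toContinuousLinearEquiv :=
    ContinuousLinearMap.ext_on hv (by rintro _ ⟨i, rfl⟩; exact h i)
  exact LinearIsometryEquiv.ext fun x => DFunLike.congr_fun heq x

theorem existsUnique_rep_of_inner_mul_left {G : Type*} [Group G] [CompleteSpace E] {v : G → E}
    (hv : Dense (Submodule.span 𝕜 (Set.range v) : Set E))
    (h : ∀ g i j, inner 𝕜 (v (g * i)) (v (g * j)) = inner 𝕜 (v i) (v j)) :
    ∃! U : G →* (E ≃ₗᵢ[𝕜] E), ∀ g i, U g (v i) = v (g * i) := by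
  have hv_mul g : Dense (Submodule.span 𝕜 (Set.range fun i => v (g * i)) : Set E) := by
    rwa [← (Equiv.mulLeft g).surjective.range_comp v] at hv
  choose T hT using fun g => exists_linearIsometryEquiv_of_inner_eq hv (hv_mul g) (h g)
  have hT_mul a b : T (a * b) = T a * T b :=
    linearIsometryEquiv_ext_of_dense_span hv fun i => by
      simp [hT, mul_assoc]
  exact ⟨.mk' T hT_mul, hT, fun U hU => MonoidHom.ext fun g =>
    linearIsometryEquiv_ext_of_dense_span hv fun i => (hU g i).trans (hT g i).symm⟩

end GramMatrix

section PolarDecomposition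

theorem exists_linearIsometry_of_norm_eq {𝕜 V E E' : Type*} [NontriviallyNormedField 𝕜]
    [AddCommGroup V] [Module 𝕜 V] [NormedAddCommGroup E] [NormedSpace 𝕜 E]
    [NormedAddCommGroup E'] [NormedSpace 𝕜 E'] [CompleteSpace E']
    {e : V →ₗ[𝕜] E} {f : V →ₗ[𝕜] E'} (he : DenseRange e) (h : ∀ x, ‖f x‖ = ‖e x‖) :
    ∃ T : E →ₗᵢ[𝕜] E', ∀ x, T (e x) = f x := by
  have hT := LinearMap.extendOfNorm_eq he ⟨1, fun x => by rw [h, one_mul]⟩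
  refine ⟨⟨(f.extendOfNorm e).toLinearMap, congrFun (he.equalizer
    (f.extendOfNorm e).continuous.norm continuous_norm (funext fun x => ?_))⟩, hT⟩
  exact (congrArg norm (hT x)).trans (h x)

variable {E E' : Type*} [NormedAddCommGroup E] [InnerProductSpace ℂ E]
  [NormedAddCommGroup E'] [InnerProductSpace ℂ E'] [CompleteSpace E] [CompleteSpace E']

open ContinuousLinearMap (adjoint)

/-- The absolute value `|A| = (A*A)^{1/2}` of a bounded operator, the positive part of its polar
decomposition. -/
def modulus (A : E →L[ℂ] E') : E →L[ℂ] E := CFC.sqrt (adjoint A ∘L A)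

theorem adjoint_modulus (A : E →L[ℂ] E') : adjoint (modulus A) = modulus A :=
  (CFC.sqrt_nonneg (adjoint A ∘L A)).isSelfAdjoint

theorem modulus_modulus_apply (A : E →L[ℂ] E') (x : E) :
    modulus A (modulus A x) = adjoint A (A x) :=
  have hpos : 0 ≤ adjoint A ∘L A := (ContinuousLinearMap.nonneg_iff_isPositive _).2
    (ContinuousLinearMap.isPositive_adjoint_comp_self A)
  DFunLike.congr_fun (CFC.sqrt_mul_sqrt_self _ hpos) x

theorem norm_modulus_apply (A : E →L[ℂ] E') (x : E) : ‖modulus A x‖ = ‖A x‖ := by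
  rw [norm_eq_sqrt_re_inner (𝕜 := ℂ), norm_eq_sqrt_re_inner (𝕜 := ℂ),
    ← ContinuousLinearMap.adjoint_inner_right, adjoint_modulus, modulus_modulus_apply,
    ContinuousLinearMap.adjoint_inner_right]

theorem denseRange_modulus {A : E →L[ℂ] E'} (hA : Function.Injective A) :
    DenseRange (modulus A) := by
  have hker : (modulus A).ker = ⊥ := by
    refine LinearMap.ker_eq_bot'.2 fun x hx => (injective_iff_map_eq_zero A).1 hA x ?_
    rw [← norm_eq_zero, ← norm_modulus_apply]
    exact norm_eq_zero.2 hx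
  have hclosure : (modulus A).range.topologicalClosure = ⊤ := by
    rw [Submodule.topologicalClosure_eq_top_iff, ContinuousLinearMap.orthogonal_range,
      adjoint_modulus, hker]
  exact Submodule.dense_iff_topologicalClosure_eq_top.2 hclosure

variable {A : E →L[ℂ] E'} {S : E ≃ₗᵢ[ℂ] E} {T : E' ≃ₗᵢ[ℂ] E'}

theorem adjoint_apply_of_intertwines (h : ∀ x, A (S x) = T (A x)) (y : E') :
    adjoint A (T y) = S (adjoint A y) := by
  refine ext_inner_left ℂ fun x => ?_
  obtain ⟨x, rfl⟩ := S.surjective x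
  rw [ContinuousLinearMap.adjoint_inner_right, h, T.inner_map_map, S.inner_map_map,
    ContinuousLinearMap.adjoint_inner_right]

theorem modulus_apply_of_intertwines (h : ∀ x, A (S x) = T (A x)) (x : E) :
    modulus A (S x) = S (modulus A x) := by
  have hcomm : Commute (adjoint A ∘L A) (S.toContinuousLinearEquiv : E →L[ℂ] E) :=
    ContinuousLinearMap.ext fun x => show adjoint A (A (S x)) = S (adjoint A (A x)) by
      rw [h, adjoint_apply_of_intertwines h]
  exact DFunLike.congr_fun (hcomm.cfcₙ_nnreal NNReal.sqrt) x

theorem exists_linearIsometry_intertwining (hA : Function.Injective A) :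
    ∃ V : E →ₗᵢ[ℂ] E', ∀ (S : E ≃ₗᵢ[ℂ] E) (T : E' ≃ₗᵢ[ℂ] E'),
      (∀ x, A (S x) = T (A x)) → ∀ x, V (S x) = T (V x) := by
  have hdense : DenseRange (modulus A : E →ₗ[ℂ] E) := denseRange_modulus hA
  obtain ⟨V, hV⟩ := exists_linearIsometry_of_norm_eq (f := (A : E →ₗ[ℂ] E')) hdense
    fun x => (norm_modulus_apply A x).symm
  replace hV : ∀ x, V (modulus A x) = A x := hV
  refine ⟨V, fun S T h => congrFun (hdense.equalizer (V.continuous.comp S.continuous)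
    (T.continuous.comp V.continuous) (funext fun x => ?_))⟩
  calc V (S (modulus A x)) = V (modulus A (S x)) := by rw [modulus_apply_of_intertwines h]
    _ = A (S x) := hV _
    _ = T (A x) := h x
    _ = T (V (modulus A x)) := by rw [hV]

end PolarDecomposition

section AnalysisOperator

theorem eq_zero_of_forall_inner_eq_zero {𝕜 ι E : Type*} [RCLike 𝕜] [NormedAddCommGroup E]
    [InnerProductSpace 𝕜 E] {w : ι → E} (hw : Dense (Submodule.span 𝕜 (Set.range w) : Set E))
    {x : E} (h : ∀ i, inner 𝕜 (w i) x = 0) : x = 0 := by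
  refine hw.eq_zero_of_inner_right 𝕜 fun y hy => ?_
  have hle : Submodule.span 𝕜 (Set.range w) ≤ (𝕜 ∙ x)ᗮ :=
    Submodule.span_le.2 <| Set.range_subset_iff.2 fun i =>
      Submodule.mem_orthogonal_singleton_iff_inner_left.2 (h i)
  exact Submodule.mem_orthogonal_singleton_iff_inner_left.1 (hle hy)

theorem starProjection_apply_of_mem_iff {𝕜 E : Type*} [RCLike 𝕜] [NormedAddCommGroup E]
    [InnerProductSpace 𝕜 E] {K : Submodule 𝕜 E} [K.HasOrthogonalProjection] {Φ : E ≃ₗᵢ[𝕜] E}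
    (hΦ : ∀ z, Φ z ∈ K ↔ z ∈ K) (z : E) : K.starProjection (Φ z) = Φ (K.starProjection z) := by
  refine Submodule.eq_starProjection_of_mem_of_inner_eq_zero
    ((hΦ _).2 (Submodule.starProjection_apply_mem K z)) fun y hy => ?_
  obtain ⟨y, rfl⟩ := Φ.surjective y
  rw [← map_sub, Φ.inner_map_map]
  exact Submodule.starProjection_inner_eq_zero z y ((hΦ y).1 hy)

variable {𝕜 ι E : Type*} [RCLike 𝕜] [NormedAddCommGroup E] [InnerProductSpace 𝕜 E]

/-- The graph of the analysis operator `x ↦ (⟨w i, x⟩)_i` of a family `w`, a closed, possibly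
unbounded operator to `ℓ²(ι)` whose domain consists of the `x` with square summable
coefficients. -/
def analysisGraph (w : ι → E) : Submodule 𝕜 (WithLp 2 (E × lp (fun _ : ι => 𝕜) 2)) where
  carrier := {z | ∀ i, z.snd i = inner 𝕜 (w i) z.fst}
  zero_mem' i := by simp
  add_mem' {a b} ha hb i := by
    simp only [Set.mem_ofPred_eq] at ha hb
    simp [ha i, hb i, inner_add_right]
  smul_mem' c a ha i := by
    simp only [Set.mem_ofPred_eq] at ha
    simp [ha i, inner_smul_right]

theorem mem_analysisGraph {w : ι → E} {z : WithLp 2 (E × lp (fun _ : ι => 𝕜) 2)} :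
    z ∈ analysisGraph w ↔ ∀ i, z.snd i = inner 𝕜 (w i) z.fst := Iff.rfl

theorem isClosed_analysisGraph (w : ι → E) :
    IsClosed (analysisGraph (𝕜 := 𝕜) w : Set (WithLp 2 (E × lp (fun _ : ι => 𝕜) 2))) := by
  have hsnd : Continuous fun z : WithLp 2 (E × lp (fun _ : ι => 𝕜) 2) => z.snd := by fun_prop
  have hset : (analysisGraph (𝕜 := 𝕜) w : Set (WithLp 2 (E × lp (fun _ : ι => 𝕜) 2))) =
      ⋂ i, {z | z.snd i = inner 𝕜 (w i) z.fst} := by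
    ext z
    simp [mem_analysisGraph]
  rw [hset]
  refine isClosed_iInter fun i => isClosed_eq ?_ (by fun_prop)
  exact (continuous_apply i).comp <|
    (lp.uniformContinuous_coe (p := 2)).continuous.comp hsnd

variable [CompleteSpace E]

instance (w : ι → E) :
    CompleteSpace (analysisGraph w : Submodule 𝕜 (WithLp 2 (E × lp (fun _ : ι => 𝕜) 2))) :=
  (isClosed_analysisGraph w).completeSpace_coe

/-- For the analysis operator `A` of `w`, this sends `x` to the second component of the projection
of `(x, 0)` onto the graph of `A`. It is the bounded operator `A(1 + A*A)⁻¹` when `A` is densely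
defined, and it intertwines whatever `A` does. -/
def boundedAnalysis (w : ι → E) : E →L[𝕜] lp (fun _ : ι => 𝕜) 2 :=
  WithLp.sndL 2 𝕜 E (lp (fun _ : ι => 𝕜) 2) ∘L (analysisGraph w).starProjection ∘L
    (WithLp.prodContinuousLinearEquiv 2 𝕜 E (lp (fun _ : ι => 𝕜) 2)).symm ∘L
      ContinuousLinearMap.inl 𝕜 E (lp (fun _ : ι => 𝕜) 2)

theorem boundedAnalysis_apply (w : ι → E) (x : E) :
    boundedAnalysis w x =
      ((analysisGraph w).starProjection
        (WithLp.toLp 2 (x, (0 : lp (fun _ : ι => 𝕜) 2)))).snd := rfl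

theorem boundedAnalysis_injective {w : ι → E}
    (hw : Dense (Submodule.span 𝕜 (Set.range w) : Set E))
    (hdom : ∀ j, Memℓp (fun i => inner 𝕜 (w i) (w j)) 2) :
    Function.Injective (boundedAnalysis (𝕜 := 𝕜) w) := by
  refine (injective_iff_map_eq_zero _).2 fun x hx => ?_
  rw [boundedAnalysis_apply] at hx
  set z : WithLp 2 (E × lp (fun _ : ι => 𝕜) 2) := WithLp.toLp 2 (x, 0)
  set p := (analysisGraph w).starProjection z
  have hp : p ∈ analysisGraph w := Submodule.starProjection_apply_mem _ _
  have hp_fst : p.fst = 0 := eq_zero_of_forall_inner_eq_zero hw fun i => by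
    rw [← hp i, hx, lp.coeFn_zero, Pi.zero_apply]
  have hp_zero : p = 0 := WithLp.ofLp_injective 2 (Prod.ext hp_fst hx)
  have hz : z ∈ (analysisGraph w)ᗮ :=
    (Submodule.starProjection_apply_eq_zero_iff _).1 hp_zero
  refine eq_zero_of_forall_inner_eq_zero hw fun j => ?_
  have hj : WithLp.toLp 2 (w j, ⟨_, hdom j⟩) ∈ analysisGraph w := fun i => rfl
  simpa [z, WithLp.prod_inner_apply] using hz _ hj

theorem boundedAnalysis_apply_of_permutes {w : ι → E} {σ : Equiv.Perm ι} {S : E ≃ₗᵢ[𝕜] E}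
    {T : lp (fun _ : ι => 𝕜) 2 ≃ₗᵢ[𝕜] lp (fun _ : ι => 𝕜) 2} (hS : ∀ i, S (w i) = w (σ i))
    (hT : ∀ y i, T y (σ i) = y i) (x : E) :
    boundedAnalysis w (S x) = T (boundedAnalysis w x) := by
  let Φ := LinearIsometryEquiv.withLpProdCongr 2 S T
  have hΦ z : Φ z ∈ analysisGraph w ↔ z ∈ analysisGraph w := by
    rw [mem_analysisGraph, mem_analysisGraph, ← σ.forall_congr_right]
    refine forall_congr' fun i => ?_
    change T z.snd (σ i) = inner 𝕜 (w (σ i)) (S z.fst) ↔ _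
    rw [hT, ← hS, S.inner_map_map]
  have hx : WithLp.toLp 2 (S x, 0) = Φ (WithLp.toLp 2 (x, 0)) :=
    WithLp.ofLp_injective 2 (Prod.ext rfl (map_zero T).symm)
  rw [boundedAnalysis_apply, boundedAnalysis_apply, hx, starProjection_apply_of_mem_iff hΦ]
  rfl

end AnalysisOperator

section RegularRepresentation

variable {G E : Type*} [Group G] [NormedAddCommGroup E] [InnerProductSpace ℂ E]
  {π : G →* (E ≃ₗᵢ[ℂ] E)}

theorem equivSubrepresentation_of_linearIsometry [CompleteSpace E] {E' : Type*}
    [NormedAddCommGroup E'] [InnerProductSpace ℂ E'] {ρ : G →* (E' ≃ₗᵢ[ℂ] E')} (V : E →ₗᵢ[ℂ] E')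
    (hV : ∀ g x, V (π g x) = ρ g (V x)) : EquivSubrepresentation π ρ := by
  refine ⟨V.toLinearMap.range, ?_, ?_, V.equivRange, hV⟩
  · rw [LinearMap.coe_range]
    exact V.isometry.isClosedEmbedding.isClosed_range
  · rintro g _ ⟨x, rfl⟩
    exact ⟨π g x, hV g x⟩

theorem inner_rep_inv_mul (g h : G) (x y : E) :
    inner ℂ x (π (g⁻¹ * h) y) = inner ℂ (π g x) (π h y) := by
  rw [← (π g).inner_map_map x, ← Function.comp_apply (f := π g), ← LinearIsometryEquiv.coe_mul,
    ← map_mul, mul_inv_cancel_left]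

theorem memℓp_inner_orbit {v : E} (hsum : Summable fun g => ‖inner ℂ v (π g v)‖ ^ 2) (h : G) :
    Memℓp (fun g => inner ℂ (π g v) (π h v)) 2 := by
  refine (memℓp_gen_iff (p := 2) (by norm_num)).2 ?_
  refine (((Equiv.inv G).trans (Equiv.mulRight h)).summable_iff.2 hsum).congr fun g => ?_
  simp only [Function.comp_apply, Equiv.trans_apply, Equiv.inv_apply, Equiv.coe_mulRight,
    inner_rep_inv_mul, ENNReal.toReal_ofNat, Real.rpow_ofNat]

theorem equivSubrepresentation_leftRegular [CompleteSpace E] {v : E}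
    (hv : Dense (Submodule.span ℂ (Set.range fun g => π g v) : Set E))
    (hsum : Summable fun g => ‖inner ℂ v (π g v)‖ ^ 2) :
    EquivSubrepresentation π (leftRegular G) := by
  obtain ⟨V, hV⟩ := exists_linearIsometry_intertwining
    (boundedAnalysis_injective hv (memℓp_inner_orbit hsum))
  refine equivSubrepresentation_of_linearIsometry V fun k =>
    hV _ _ (boundedAnalysis_apply_of_permutes (σ := Equiv.mulLeft k) (fun g => ?_) fun y g => ?_)
  · simp
  · exact congrArg y (inv_mul_cancel_left k g)

end RegularRepresentation

section SpectrallyLebesgue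

theorem norm_avg_le {ι E : Type*} [SeminormedAddCommGroup E] [NormedSpace ℝ E] {A : Finset ι}
    {φ : ι → E} {C : ℝ} (hC : 0 ≤ C) (hφ : ∀ x ∈ A, ‖φ x‖ ≤ C) : ‖avg A φ‖ ≤ C := by
  have hsum : ‖∑ x ∈ A, φ x‖ ≤ A.card * C := by
    simpa only [Finset.sum_const, nsmul_eq_mul] using norm_sum_le_of_le A hφ
  rw [avg, norm_smul, norm_inv, Real.norm_natCast]
  exact inv_mul_le_of_le_mul₀ (Nat.cast_nonneg _) hC hsum

theorem norm_inner_le_of_bounded {𝕜 ι H : Type*} [RCLike 𝕜] [SeminormedAddCommGroup H]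
    [InnerProductSpace 𝕜 H] {u : ι → H} {C : ℝ} (hu : ∀ i, ‖u i‖ ≤ C) (i j : ι) :
    ‖inner 𝕜 (u i) (u j)‖ ≤ C * C :=
  (norm_inner_le_norm _ _).trans
    (mul_le_mul (hu i) (hu j) (norm_nonneg _) ((norm_nonneg _).trans (hu i)))

variable {G H : Type*} [Group G] [NormedAddCommGroup H] [InnerProductSpace ℂ H]
  {F : ℕ → Finset G} {u : G → H}

theorem tendsto_inner_cls (P : PermissiblePair F (fun h : G => translate h u)) (i j : G) :
    Tendsto (fun q => avg (P.sets q) (fun g => inner ℂ (u (g * i)) (u (g * j)))) atTop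
      (𝓝 (inner ℂ (P.cls i) (P.cls j))) :=
  P.tendsto_preInner (.mk (translate i u) (P.mem_preSubmodule i))
    (.mk (translate j u) (P.mem_preSubmodule j))

theorem inner_cls_mul_left (hF : IsRightFolner F) {C : ℝ} (hu : ∀ g, ‖u g‖ ≤ C)
    (P : PermissiblePair F (fun h : G => translate h u)) (g i j : G) :
    inner ℂ (P.cls (g * i)) (P.cls (g * j)) = inner ℂ (P.cls i) (P.cls j) := by
  have hφ x : ‖inner ℂ (u (x * i)) (u (x * j))‖ ≤ C * C := norm_inner_le_of_bounded hu _ _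
  have h := (hF.tendsto_avg_mul_right_sub hφ g).comp P.strictMono.tendsto_atTop
  simp only [Function.comp_def, mul_assoc] at h
  have h' := (tendsto_inner_cls P (g * i) (g * j)).sub (tendsto_inner_cls P i j)
  exact sub_eq_zero.1 (tendsto_nhds_unique h' h)

theorem norm_inner_cls_one_sq_le_limsup {C : ℝ} (hu : ∀ g, ‖u g‖ ≤ C)
    (P : PermissiblePair F (fun h : G => translate h u)) (h : G) :
    ‖inner ℂ (P.cls 1) (P.cls h)‖ ^ 2 ≤
      limsup (fun n => ‖avg (F n) (fun g => inner ℂ (u g) (u (g * h)))‖ ^ 2) atTop := by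
  have hbdd : IsBoundedUnder (· ≤ ·) atTop
      (fun n => ‖avg (F n) (fun g => inner ℂ (u g) (u (g * h)))‖ ^ 2) :=
    isBoundedUnder_of ⟨(C * C) ^ 2, fun n => pow_le_pow_left₀ (norm_nonneg _)
      (norm_avg_le (mul_self_nonneg C) fun g _ => norm_inner_le_of_bounded hu g (g * h)) 2⟩
  have hlim := (tendsto_inner_cls P 1 h).norm.pow 2
  simp only [mul_one] at hlim
  refine le_of_forall_gt_imp_ge_of_dense fun b hb => le_of_tendsto hlim ?_
  exact (P.strictMono.tendsto_atTop.eventually (eventually_lt_of_limsup_lt hb hbdd)).mono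
    fun q hq => hq.le

theorem completeSpace_space_of_isRightFolner (hF : IsRightFolner F)
    (P : PermissiblePair F (fun h : G => translate h u)) : CompleteSpace P.Space := by
  cases finite_or_infinite G
  · exact P.completeSpace_space_of_finite
  · exact P.completeSpace_space (hF.tendsto_card.comp P.strictMono.tendsto_atTop)

end SpectrallyLebesgue

end

end VdC

theorem mainTheorem1_general {G : Type*} [Group G]
    {H : Type*} [NormedAddCommGroup H] [InnerProductSpace ℂ H]
    (F : ℕ → Finset G) (hF : VdC.IsRightFolner F)
    (u : G → H) (hu : ∃ C : ℝ, ∀ g, ‖u g‖ ≤ C)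
    (hsum : Summable fun h : G =>
      limsup (fun n => ‖VdC.avg (F n) (fun g => inner ℂ (u g) (u (g * h)))‖ ^ 2) atTop) :
    VdC.SpectrallyLebesgue F u := by
  obtain ⟨C, hC⟩ := hu
  intro P
  have := VdC.completeSpace_space_of_isRightFolner hF P
  refine ⟨VdC.existsUnique_rep_of_inner_mul_left P.dense_span_cls
    (VdC.inner_cls_mul_left hF hC P), fun U hU => ?_⟩
  have hcls g : U g (P.cls 1) = P.cls g := by simpa using hU g 1
  refine VdC.equivSubrepresentation_leftRegular (v := P.cls 1) ?_ ?_
  · simpa only [hcls] using P.dense_span_cls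
  · simp only [hcls]
    exact hsum.of_nonneg_of_le (fun _ => sq_nonneg _) (VdC.norm_inner_cls_one_sq_le_limsup hC P)

theorem mainTheorem1 {G : Type*} [Group G] [Countable G] [Infinite G]
    {H : Type*} [NormedAddCommGroup H] [InnerProductSpace ℂ H] [CompleteSpace H]
    (F : ℕ → Finset G) (hF : VdC.IsRightFolner F)
    (u : G → H) (hu : ∃ C : ℝ, ∀ g, ‖u g‖ ≤ C)
    (hsum : Summable fun h : G =>
      limsup (fun n => ‖VdC.avg (F n) (fun g => inner ℂ (u g) (u (g * h)))‖ ^ 2) atTop) :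
    VdC.SpectrallyLebesgue F u :=
  mainTheorem1_general F hF u hu hsum
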